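/- Let $J$ be a (nonempty) directed set and let $\{{}^jG_\bullet,\varphi_i^j\}_{i\le j\in J}$ be a direct system of simplicial groups indexed by $J$. Let $\varinjlim_{j\in J}{}^jG_\bullet$ be its direct limit in the category of simplicial groups, that is, the simplicial group with $(\varinjlim_j {}^jG_\bullet)_k=\varinjlim_j({}^jG_k)$ and with faces and degeneracies the direct limits of those of the ${}^jG_\bullet$, and let ${}^j\theta:{}^jG_\bullet\to\varinjlim_{j}{}^jG_\bullet$ be the canonical morphisms. For $n\ge 0$ and a simplicial group $G_\bullet$, let $\pi_n(G_\bullet)$ be the $n$-th homotopy group of (the Kan complex underlying) $G_\bullet$ based at the neutral element: the set of homotopy classes relative to $\partial\Delta[n]$ of simplicial maps $\Delta[n]\to G_\bullet$ that send $\partial\Delta[n]$ to the neutral element, with the group law induced by the multiplication of $G_\bullet$ (for $n\ge1$ this is the usual group law of the homotopy groups of a Kan complex). Then for every $n\ge 0$ there is a group isomorphism $$\pi_n\Big(\varinjlim_{j\in J}{}^jG_\bullet\Big)\;\cong\;\varinjlim_{j\in J}\pi_n\big({}^jG_\bullet\big)$$ under which, for every $j\in J$, the homomorphism $\pi_n({}^j\theta)$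 corresponds to the canonical homomorphism $\pi_n({}^jG_\bullet)\to\varinjlim_{j\in J}\pi_n({}^jG_\bullet)$. -/

import Mathlib

open CategoryTheory Limits Simplicial MonoidalCategory CartesianMonoidalCategory

universe u

namespace SimplicialGroup

/-- The underlying simplicial set of a simplicial group, as a functor. -/
abbrev toSSet : SimplicialObject GrpCat.{u} ⥤ SSet.{u} :=
  (SimplicialObject.whiskering GrpCat.{u} (Type u)).obj (forget GrpCat.{u})

section PointwiseGroup

variable {G : SimplicialObject GrpCat.{u}} {X Y : SSet.{u}}

/-- The value of a simplicial map to a simplicial group, as a group element. -/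
def ev (f : X ⟶ toSSet.obj G) (k : SimplexCategoryᵒᵖ) (x : X.obj k) : G.obj k :=
  f.app k x

lemma hom_ext_ev {f g : X ⟶ toSSet.obj G} (h : ∀ k x, ev f k x = ev g k x) : f = g := by
  ext k x
  exact h k x

lemma ev_map (f : X ⟶ toSSet.obj G) {k l : SimplexCategoryᵒᵖ} (a : k ⟶ l) (x : X.obj k) :
    ev f l (X.map a x) = (G.map a).hom (ev f k x) :=
  NatTrans.naturality_apply f a x

/-- The simplicial map with given compatible values in a simplicial group. -/
def homMk (v : ∀ k : SimplexCategoryᵒᵖ, X.obj k → G.obj k)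
    (hv : ∀ {k l : SimplexCategoryᵒᵖ} (a : k ⟶ l) (x : X.obj k),
      v l (X.map a x) = (G.map a).hom (v k x)) : X ⟶ toSSet.obj G where
  app k := ↾(v k)
  naturality k l a := by
    ext x
    exact hv a x

/-- Simplicial maps from a simplicial set to a simplicial group can be multiplied pointwise. -/
instance : Mul (X ⟶ toSSet.obj G) where
  mul f g := homMk (fun k x ↦ ev f k x * ev g k x) (fun a x ↦ by rw [ev_map, ev_map, map_mul])

/-- The constant simplicial map with value the neutral element. -/
instance : One (X ⟶ toSSet.obj G) where
  one := SSet.const (X := X) (Y := toSSet.obj G) (1 : G.obj (.op ⦋0⦌))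

/-- The pointwise inverse of a simplicial map to a simplicial group. -/
instance : Inv (X ⟶ toSSet.obj G) where
  inv f := homMk (fun k x ↦ (ev f k x)⁻¹) (fun a x ↦ by rw [ev_map, map_inv])

lemma ev_mul (f g : X ⟶ toSSet.obj G) (k : SimplexCategoryᵒᵖ) (x : X.obj k) :
    ev (f * g) k x = ev f k x * ev g k x := rfl

lemma ev_inv (f : X ⟶ toSSet.obj G) (k : SimplexCategoryᵒᵖ) (x : X.obj k) :
    ev f⁻¹ k x = (ev f k x)⁻¹ := rfl

lemma ev_one (k : SimplexCategoryᵒᵖ) (x : X.obj k) : ev (1 : X ⟶ toSSet.obj G) k x = 1 :=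
  (G.map _).hom.map_one

instance : Group (X ⟶ toSSet.obj G) where
  mul_assoc f g h := hom_ext_ev fun k x ↦ by simp only [ev_mul, mul_assoc]
  one_mul f := hom_ext_ev fun k x ↦ by rw [ev_mul, ev_one, one_mul]
  mul_one f := hom_ext_ev fun k x ↦ by rw [ev_mul, ev_one, mul_one]
  inv_mul_cancel f := hom_ext_ev fun k x ↦ by rw [ev_mul, ev_inv, ev_one, inv_mul_cancel]

lemma comp_mul (p : X ⟶ Y) (f g : Y ⟶ toSSet.obj G) : p ≫ (f * g) = (p ≫ f) * (p ≫ g) := rfl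

lemma comp_inv (p : X ⟶ Y) (f : Y ⟶ toSSet.obj G) : p ≫ f⁻¹ = (p ≫ f)⁻¹ := rfl

lemma comp_one (p : X ⟶ Y) : p ≫ (1 : Y ⟶ toSSet.obj G) = 1 := rfl

lemma mul_comp (f g : X ⟶ toSSet.obj G) {H : SimplicialObject GrpCat.{u}} (φ : G ⟶ H) :
    (f * g) ≫ toSSet.map φ = (f ≫ toSSet.map φ) * (g ≫ toSSet.map φ) :=
  hom_ext_ev fun k x ↦ (φ.app k).hom.map_mul (ev f k x) (ev g k x)

end PointwiseGroup

/-- The base point of a simplicial group: the neutral element of `G₀`. -/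
abbrev basePoint (G : SimplicialObject GrpCat.{u}) : (toSSet.obj G) _⦋0⦌ :=
  (1 : G.obj (.op ⦋0⦌))

/-- The spherical `n`-simplices of `G`: maps `Δ[n] ⟶ G` that send `∂Δ[n]` to the base point. -/
abbrev Sphere (G : SimplicialObject GrpCat.{u}) (n : ℕ) : Type u :=
  (toSSet.obj G).PtSimplex n (basePoint G)

lemma Sphere.boundary_map {G : SimplicialObject GrpCat.{u}} {n : ℕ} (f : Sphere G n) :
    (SSet.boundary n).ι ≫ f.map = 1 := f.comm

variable {G H : SimplicialObject GrpCat.{u}} {n : ℕ}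

/-- Spherical simplices form a group under pointwise multiplication. -/
instance : Mul (Sphere G n) where
  mul f g :=
    { map := f.map * g.map
      comm := by
        change _ = (1 : _ ⟶ toSSet.obj G)
        rw [comp_mul, f.boundary_map, g.boundary_map, one_mul] }

instance : One (Sphere G n) where
  one := SSet.RelativeMorphism.const

instance : Inv (Sphere G n) where
  inv f :=
    { map := f.map⁻¹
      comm := by
        change _ = (1 : _ ⟶ toSSet.obj G)
        rw [comp_inv, f.boundary_map, inv_one] }

@[simp] lemma Sphere.mul_map (f g : Sphere G n) : (f * g).map = f.map * g.map := rfl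

@[simp] lemma Sphere.one_map : (1 : Sphere G n).map = 1 := rfl

@[simp] lemma Sphere.inv_map (f : Sphere G n) : (f⁻¹).map = f.map⁻¹ := rfl

instance : Group (Sphere G n) where
  mul_assoc f g h := SSet.RelativeMorphism.ext (mul_assoc f.map g.map h.map)
  one_mul f := SSet.RelativeMorphism.ext (one_mul f.map)
  mul_one f := SSet.RelativeMorphism.ext (mul_one f.map)
  inv_mul_cancel f := SSet.RelativeMorphism.ext (inv_mul_cancel f.map)

/-- Homotopies relative to the boundary can be multiplied pointwise. -/
noncomputable def homotopyMul {f f' g g' : Sphere G n}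
    (h : SSet.RelativeMorphism.Homotopy f f') (k : SSet.RelativeMorphism.Homotopy g g') :
    SSet.RelativeMorphism.Homotopy (f * g) (f' * g') where
  h := h.h * k.h
  h₀ := by rw [comp_mul, h.h₀, k.h₀, Sphere.mul_map]
  h₁ := by rw [comp_mul, h.h₁, k.h₁, Sphere.mul_map]
  rel := by
    change _ = (1 : _ ⟶ toSSet.obj G)
    have hh : _ = (1 : _ ⟶ toSSet.obj G) := h.rel
    have hk : _ = (1 : _ ⟶ toSSet.obj G) := k.rel
    rw [comp_mul, hh, hk, one_mul]

/-- Homotopies relative to the boundary can be inverted pointwise. -/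
noncomputable def homotopyInv {f f' : Sphere G n} (h : SSet.RelativeMorphism.Homotopy f f') :
    SSet.RelativeMorphism.Homotopy f⁻¹ f'⁻¹ where
  h := h.h⁻¹
  h₀ := by rw [comp_inv, h.h₀, Sphere.inv_map]
  h₁ := by rw [comp_inv, h.h₁, Sphere.inv_map]
  rel := by
    change _ = (1 : _ ⟶ toSSet.obj G)
    have hh : _ = (1 : _ ⟶ toSSet.obj G) := h.rel
    rw [comp_inv, hh, inv_one]

/-- The set `πₙ(G)` underlying the `n`-th homotopy group of the simplicial group `G`: homotopy
classes, relative to `∂Δ[n]`, of maps `Δ[n] ⟶ G` sending `∂Δ[n]` to the neutral element.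
No fibrant replacement is needed because a simplicial group is a Kan complex. -/
abbrev Pi (n : ℕ) (G : SimplicialObject GrpCat.{u}) : Type u :=
  SSet.RelativeMorphism.HomotopyClass (SSet.boundary n)
    (SSet.Subcomplex.ofSimplex (basePoint G))
    (SSet.const ⟨basePoint G, SSet.Subcomplex.mem_ofSimplex_obj (basePoint G)⟩)

/-- The class of a spherical simplex in `πₙ(G)`. -/
abbrev piMk (f : Sphere G n) : Pi n G := f.homotopyClass

/-- The group law on `πₙ(G)` is induced by the multiplication of `G`. For `n ≥ 1` it is the usual
group law on the homotopy groups of a Kan complex, see `mulStruct`. -/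
instance : Mul (Pi n G) where
  mul := Quot.map₂ (fun f g ↦ f * g)
    (fun f _ _ ⟨h⟩ ↦ ⟨homotopyMul (.refl f) h⟩) (fun _ _ g ⟨h⟩ ↦ ⟨homotopyMul h (.refl g)⟩)

instance : One (Pi n G) where
  one := piMk 1

instance : Inv (Pi n G) where
  inv := Quot.map (fun f ↦ f⁻¹) (fun _ _ ⟨h⟩ ↦ ⟨homotopyInv h⟩)

lemma piMk_mul (f g : Sphere G n) : piMk (f * g) = piMk f * piMk g := rfl

instance : Group (Pi n G) where
  mul_assoc := by
    rintro ⟨f⟩ ⟨g⟩ ⟨h⟩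
    exact congrArg piMk (mul_assoc f g h)
  one_mul := by
    rintro ⟨f⟩
    exact congrArg piMk (one_mul f)
  mul_one := by
    rintro ⟨f⟩
    exact congrArg piMk (mul_one f)
  inv_mul_cancel := by
    rintro ⟨f⟩
    exact congrArg piMk (inv_mul_cancel f)

/-- For `n ≥ 1` the group law on `πₙ(G)` is the one of the Kan complex underlying `G`: there is
an `(n + 1)`-simplex, with `g`, `f * g`, `f` as three consecutive faces and the other faces
constant, exhibiting `f * g` as a product of `f` and `g`. -/
noncomputable def mulStruct (f g : Sphere G n) (i : Fin n) :
    SSet.PtSimplex.MulStruct f g (f * g) i where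
  map := (SSet.PtSimplex.MulStruct.mulOne f i).map * (SSet.PtSimplex.MulStruct.oneMul g i).map
  δ_castSucc_castSucc_map := by
    rw [comp_mul, SSet.PtSimplex.MulStruct.δ_castSucc_castSucc_map,
      SSet.PtSimplex.MulStruct.δ_castSucc_castSucc_map]
    exact one_mul g.map
  δ_succ_castSucc_map := by
    rw [comp_mul, SSet.PtSimplex.MulStruct.δ_succ_castSucc_map,
      SSet.PtSimplex.MulStruct.δ_succ_castSucc_map, Sphere.mul_map]
  δ_succ_succ_map := by
    rw [comp_mul, SSet.PtSimplex.MulStruct.δ_succ_succ_map,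
      SSet.PtSimplex.MulStruct.δ_succ_succ_map]
    exact mul_one f.map
  δ_map_of_lt j hj := by
    rw [comp_mul, SSet.PtSimplex.MulStruct.δ_map_of_lt _ j hj,
      SSet.PtSimplex.MulStruct.δ_map_of_lt _ j hj]
    exact one_mul (1 : _ ⟶ toSSet.obj G)
  δ_map_of_gt j hj := by
    rw [comp_mul, SSet.PtSimplex.MulStruct.δ_map_of_gt _ j hj,
      SSet.PtSimplex.MulStruct.δ_map_of_gt _ j hj]
    exact one_mul (1 : _ ⟶ toSSet.obj G)

/-- A morphism of simplicial groups, as a map of pointed simplicial sets. -/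
abbrev pointedMap (φ : G ⟶ H) :
    SSet.RelativeMorphism (.ofSimplex (basePoint G)) (.ofSimplex (basePoint H))
      (SSet.const ⟨basePoint H, SSet.Subcomplex.mem_ofSimplex_obj (basePoint H)⟩) :=
  SSet.RelativeMorphism.ofSimplex₀ (toSSet.map φ) (basePoint G) (basePoint H)
    (φ.app (.op ⦋0⦌)).hom.map_one

/-- The homomorphism `πₙ(φ) : πₙ(G) → πₙ(H)`, `[f] ↦ [φ ∘ f]`. -/
def piMap (n : ℕ) (φ : G ⟶ H) : Pi n G →* Pi n H :=
  MonoidHom.mk' (fun x ↦ x.postcomp (pointedMap φ) rfl) (by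
    rintro ⟨f⟩ ⟨g⟩
    exact congrArg piMk (SSet.RelativeMorphism.ext (mul_comp f.map g.map φ)))

/-- The `n`-th homotopy group, as a functor from simplicial groups to groups. -/
def homotopyGroup (n : ℕ) : SimplicialObject GrpCat.{u} ⥤ GrpCat.{u} where
  obj G := GrpCat.of (Pi n G)
  map φ := GrpCat.ofHom (piMap n φ)
  map_id G := by
    ext ⟨f⟩
    rfl
  map_comp φ ψ := by
    ext ⟨f⟩
    rfl

/-- Directed systems of groups have direct limits. -/
instance (J : Type u) [Preorder J] [IsDirectedOrder J] [Nonempty J] :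
    HasColimitsOfShape J GrpCat.{u} where
  has_colimit F := ⟨⟨_, GrpCat.FilteredColimits.colimitCoconeIsColimit F⟩⟩

end SimplicialGroup

namespace SimplicialGroup

section FilteredColimit

variable {J : Type u} [SmallCategory J] [IsFiltered J] [HasColimitsOfShape J GrpCat.{u}]

/-! The simplicial sets `Δ[n]`, `∂Δ[n]` and `Δ[n] ⊗ Δ[1]` are finite, hence finitely presentable,
and the forgetful functor to simplicial sets preserves filtered colimits: these are computed
degreewise, and filtered colimits of groups have the expected underlying sets. So spheres and
homotopies in the colimit come from some stage, and the finitely many identities they satisfy hold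
at a later one. Lifting spheres (`Sphere.exists_push_eq_of_isColimit`) makes the comparison map
`colimit.post` surjective; lifting homotopies (`Sphere.exists_homotopy_push_of_isColimit`) makes it
injective. It is a homomorphism by construction, so bijectivity suffices. -/

instance preservesColimitsOfShape_toSSet : PreservesColimitsOfShape J toSSet.{u} :=
  inferInstanceAs (PreservesColimitsOfShape J
    ((Functor.whiskeringRight SimplexCategoryᵒᵖ GrpCat.{u} (Type u)).obj (forget GrpCat.{u})))

variable {F : J ⥤ SimplicialObject GrpCat.{u}} {c : Cocone F}

/-- A map from a finite simplicial set to a filtered colimit of simplicial groups factors through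
one of them. -/
lemma exists_hom_of_isColimit (hc : IsColimit c) {X : SSet.{u}} [X.Finite]
    (f : X ⟶ toSSet.obj c.pt) :
    ∃ (j : J) (g : X ⟶ toSSet.obj (F.obj j)), g ≫ toSSet.map (c.ι.app j) = f :=
  IsFinitelyPresentable.exists_hom_of_isColimit (isColimitOfPreserves toSSet hc) f

/-- Two maps from a finite simplicial set to a term of a filtered system of simplicial groups
which agree in the colimit agree at a later term. -/
lemma exists_eq_of_isColimit (hc : IsColimit c) {X : SSet.{u}} [X.Finite] {j : J}
    (f g : X ⟶ toSSet.obj (F.obj j))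
    (h : f ≫ toSSet.map (c.ι.app j) = g ≫ toSSet.map (c.ι.app j)) :
    ∃ (k : J) (a : j ⟶ k), f ≫ toSSet.map (F.map a) = g ≫ toSSet.map (F.map a) :=
  exists_eq_of_preservesColimit_coyoneda_self (isColimitOfPreserves toSSet hc) f g h

lemma one_comp {X : SSet.{u}} {G H : SimplicialObject GrpCat.{u}} (φ : G ⟶ H) :
    (1 : X ⟶ toSSet.obj G) ≫ toSSet.map φ = 1 :=
  hom_ext_ev fun k x ↦ by
    rw [ev_one]
    change (φ.app k).hom (ev (1 : X ⟶ toSSet.obj G) k x) = 1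
    rw [ev_one, map_one]

/-- The image of a spherical simplex under a morphism of simplicial groups. -/
abbrev Sphere.push {G H : SimplicialObject GrpCat.{u}} {n : ℕ} (f : Sphere G n) (φ : G ⟶ H) :
    Sphere H n :=
  f.comp (pointedMap φ) rfl

omit [IsFiltered J] [HasColimitsOfShape J GrpCat.{u}] in
lemma toSSet_map_comp_ι {i j : J} (a : i ⟶ j) :
    toSSet.map (F.map a) ≫ toSSet.map (c.ι.app j) = toSSet.map (c.ι.app i) := by
  rw [← Functor.map_comp, c.w]

variable {n : ℕ}

lemma Sphere.exists_push_eq_of_isColimit (hc : IsColimit c) (f : Sphere c.pt n) :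
    ∃ (j : J) (g : Sphere (F.obj j) n), g.push (c.ι.app j) = f := by
  obtain ⟨i, g, hg⟩ := exists_hom_of_isColimit hc f.map
  -- The lift `g` need not be trivial on `∂Δ[n]`, but it becomes so in the colimit, hence already at
  -- a later stage.
  obtain ⟨j, a, ha⟩ := exists_eq_of_isColimit hc ((SSet.boundary n).ι ≫ g) 1 (by
    rw [Category.assoc, hg, f.boundary_map, one_comp])
  refine ⟨j, { map := g ≫ toSSet.map (F.map a), comm := ?_ }, SSet.RelativeMorphism.ext ?_⟩
  · change _ = (1 : _ ⟶ toSSet.obj (F.obj j))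
    rw [← Category.assoc, ha, one_comp]
  · change (g ≫ toSSet.map (F.map a)) ≫ toSSet.map (c.ι.app j) = f.map
    rw [Category.assoc, toSSet_map_comp_ι, hg]

/-- A homotopy in a filtered colimit between spherical simplices of terms of the system is defined
at a later term. -/
lemma Sphere.exists_homotopy_push_of_isColimit (hc : IsColimit c) {i j : J}
    (f : Sphere (F.obj i) n) (g : Sphere (F.obj j) n)
    (h : SSet.RelativeMorphism.Homotopy (f.push (c.ι.app i)) (g.push (c.ι.app j))) :
    ∃ (k : J) (a : i ⟶ k) (b : j ⟶ k),
      Nonempty (SSet.RelativeMorphism.Homotopy (f.push (F.map a)) (g.push (F.map b))) := by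
  obtain ⟨l, h', hh⟩ := exists_hom_of_isColimit hc h.h
  obtain ⟨m, a, b, d, -⟩ : ∃ (m : J) (_ : i ⟶ m) (_ : j ⟶ m) (_ : l ⟶ m), True :=
    ⟨IsFiltered.max₃ i j l, IsFiltered.firstToMax₃ .., IsFiltered.secondToMax₃ ..,
      IsFiltered.thirdToMax₃ .., trivial⟩
  -- The two end conditions and the boundary condition hold in the colimit; each is achieved at its
  -- own stage beyond `m`.
  obtain ⟨m₀, a₀, h₀⟩ := exists_eq_of_isColimit hc
    (SSet.ι₀ ≫ h' ≫ toSSet.map (F.map d)) (f.map ≫ toSSet.map (F.map a)) (by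
      simp only [Category.assoc, toSSet_map_comp_ι, hh]
      exact h.h₀)
  obtain ⟨m₁, a₁, h₁⟩ := exists_eq_of_isColimit hc
    (SSet.ι₁ ≫ h' ≫ toSSet.map (F.map d)) (g.map ≫ toSSet.map (F.map b)) (by
      simp only [Category.assoc, toSSet_map_comp_ι, hh]
      exact h.h₁)
  obtain ⟨m₂, a₂, h₂⟩ := exists_eq_of_isColimit hc
    ((SSet.boundary n).ι ▷ Δ[1] ≫ h' ≫ toSSet.map (F.map d)) 1 (by
      simp only [Category.assoc, toSSet_map_comp_ι, hh, one_comp]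
      exact h.rel)
  -- Parallel arrows of `J` may differ, so `k` is chosen to make the three composites `m ⟶ k` equal;
  -- a single lifted homotopy then meets all three conditions.
  obtain ⟨k, b₀, b₁, b₂, e₁, e₂⟩ : ∃ (k : J) (b₀ : m₀ ⟶ k) (b₁ : m₁ ⟶ k) (b₂ : m₂ ⟶ k),
      a₁ ≫ b₁ = a₀ ≫ b₀ ∧ a₂ ≫ b₂ = a₀ ≫ b₀ := by
    obtain ⟨p, u, v, huv⟩ := IsFiltered.span a₀ a₁
    obtain ⟨q, s, t, hst⟩ := IsFiltered.span (a₀ ≫ u) a₂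
    exact ⟨q, u ≫ s, v ≫ s, t, by rw [← reassoc_of% huv], by rw [← hst, Category.assoc]⟩
  refine ⟨k, a ≫ a₀ ≫ b₀, b ≫ a₀ ≫ b₀, ⟨{
    h := h' ≫ toSSet.map (F.map (d ≫ a₀ ≫ b₀))
    h₀ := ?_
    h₁ := ?_
    rel := ?_ }⟩⟩
  · have := h₀ =≫ toSSet.map (F.map b₀)
    simp only [Category.assoc, ← Functor.map_comp] at this
    exact this
  · have := h₁ =≫ toSSet.map (F.map b₁)
    simp only [Category.assoc, ← Functor.map_comp, e₁] at this
    exact this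
  · change _ = (1 : _ ⟶ toSSet.obj (F.obj k))
    have := h₂ =≫ toSSet.map (F.map b₂)
    simpa only [Category.assoc, ← Functor.map_comp, e₂, one_comp] using this

variable {d : Cocone (F ⋙ homotopyGroup n)}

omit [IsFiltered J] [HasColimitsOfShape J GrpCat.{u}] in
lemma ι_piMk_push {i j : J} (f : Sphere (F.obj i) n) (a : i ⟶ j) :
    d.ι.app j (piMk (f.push (F.map a))) = d.ι.app i (piMk f) :=
  ConcreteCategory.congr_hom (d.w a) (piMk f)

/-- In a cocone on the homotopy groups, the classes of spherical simplices of terms of the system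
agree as soon as they agree in the homotopy group of the colimit. -/
lemma ι_piMk_eq_of_piMk_push_eq (hc : IsColimit c) {i j : J}
    (f : Sphere (F.obj i) n) (g : Sphere (F.obj j) n)
    (h : piMk (f.push (c.ι.app i)) = piMk (g.push (c.ι.app j))) :
    d.ι.app i (piMk f) = d.ι.app j (piMk g) := by
  have of_homotopy {i j : J} (f : Sphere (F.obj i) n) (g : Sphere (F.obj j) n)
      (h : SSet.RelativeMorphism.Homotopy (f.push (c.ι.app i)) (g.push (c.ι.app j))) :
      d.ι.app i (piMk f) = d.ι.app j (piMk g) := by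
    obtain ⟨k, a, b, ⟨h'⟩⟩ := Sphere.exists_homotopy_push_of_isColimit hc f g h
    rw [← ι_piMk_push f a, ← ι_piMk_push g b]
    exact congrArg _ h'.eq
  -- Equality of classes only yields a zigzag of homotopies between spheres of `c.pt`. Quantifying
  -- over all lifts of the endpoints lets the induction run without the Kan condition.
  have key (x y : Sphere c.pt n)
      (hxy : Relation.EqvGen (fun x y ↦ Nonempty (SSet.RelativeMorphism.Homotopy x y)) x y) :
      ∀ (i j : J) (f : Sphere (F.obj i) n) (g : Sphere (F.obj j) n),
        f.push (c.ι.app i) = x → g.push (c.ι.app j) = y →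
          d.ι.app i (piMk f) = d.ι.app j (piMk g) := by
    induction hxy with
    | rel x y h =>
      rintro i j f g rfl rfl
      exact of_homotopy f g h.some
    | refl x =>
      rintro i j f g hf rfl
      exact of_homotopy f g (.ofEq hf)
    | symm x y _ ih => exact fun i j f g hf hg ↦ (ih j i g f hg hf).symm
    | trans x y z _ _ ih₁ ih₂ =>
      intro i j f g hf hg
      -- The intermediate sphere exists a priori only in the colimit; a lift of it links the two
      -- halves.
      obtain ⟨k, p, hp⟩ := Sphere.exists_push_eq_of_isColimit hc y
      exact (ih₁ i k f p hf hp).trans (ih₂ k j p g hp hg)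
  exact key _ _ (Quot.eqvGen_exact h) i j f g rfl rfl

variable (F n)

/-- The canonical comparison homomorphism from a filtered colimit of homotopy groups to the
homotopy group of the colimit is an isomorphism. -/
instance isIso_colimit_post_homotopyGroup :
    IsIso (colimit.post F (homotopyGroup n)) := by
  have post_ι (j : J) (x : Pi n (F.obj j)) :
      colimit.post F (homotopyGroup n) (colimit.ι (F ⋙ homotopyGroup n) j x) =
        piMap n (colimit.ι F j) x :=
    ConcreteCategory.congr_hom (colimit.ι_post F (homotopyGroup n) j) x
  rw [ConcreteCategory.isIso_iff_bijective]
  constructor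
  · intro x y hxy
    obtain ⟨i, x, rfl⟩ := Concrete.colimit_exists_rep _ x
    obtain ⟨j, y, rfl⟩ := Concrete.colimit_exists_rep _ y
    obtain ⟨f, rfl⟩ := SSet.RelativeMorphism.HomotopyClass.eq_homotopyClass x
    obtain ⟨g, rfl⟩ := SSet.RelativeMorphism.HomotopyClass.eq_homotopyClass y
    erw [post_ι, post_ι] at hxy
    exact ι_piMk_eq_of_piMk_push_eq (d := colimit.cocone _) (colimit.isColimit F) f g hxy
  · intro y
    obtain ⟨f, rfl⟩ := SSet.RelativeMorphism.HomotopyClass.eq_homotopyClass y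
    obtain ⟨j, g, rfl⟩ := Sphere.exists_push_eq_of_isColimit (colimit.isColimit F) f
    exact ⟨colimit.ι (F ⋙ homotopyGroup n) j (piMk g), post_ι j (piMk g)⟩

end FilteredColimit

end SimplicialGroup

theorem theorem3p2 {J : Type u} [Preorder J] [IsDirectedOrder J] [Nonempty J]
    (F : J ⥤ SimplicialObject GrpCat.{u}) (n : ℕ) :
    ∃ e : (SimplicialGroup.homotopyGroup n).obj (colimit F) ≅
        colimit (F ⋙ SimplicialGroup.homotopyGroup n),
      ∀ j : J, (SimplicialGroup.homotopyGroup n).map (colimit.ι F j) ≫ e.hom =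
        colimit.ι (F ⋙ SimplicialGroup.homotopyGroup n) j :=
  -- The comparison map starts at the colimit of the homotopy groups, so its inverse is the required
  -- isomorphism.
  ⟨(asIso (colimit.post F (SimplicialGroup.homotopyGroup n))).symm, fun j ↦ by
    rw [Iso.symm_hom, asIso_inv, IsIso.comp_inv_eq, colimit.ι_post]⟩
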